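/- **Setting.** Let $V$ be a real-analytic $n$-dimensional manifold with a real-analytic Lorentzian metric $\mathbf g$ of signature $(+,-,\dots,-)$, and with a causal orientation, i.e. a continuous timelike vector field $\vec\tau$ declared to be future directed. For $x\in V$ let $\Theta^+_x=\{\vec u\in T_xV : \mathbf g(\vec u,\vec u)\ge 0,\ \mathbf g(\vec\tau,\vec u)>0\}$ be the set of future-directed causal vectors. A *causal symmetry* of $(V,\mathbf g)$ is a smooth diffeomorphism $\varphi:V\to V$ with $\varphi'(\Theta^+_x)\subseteq\Theta^+_{\varphi(x)}$ for all $x\in V$; the set of all of them is denoted $\mathcal C(V,\mathbf g)$. For a covariant 2-tensor $\mathbf T$ at $x$, the set of its *principal directions* is $\mu(\mathbf T)=\{\vec u\in\Theta^+_x : \mathbf T(\vec u,\vec u)=0\}$. Let $I\subseteq\mathbb R$ be an interval containing $0$, and let $\{\varphi_s\}_{s\in I}$ be a real-analytic local one-parameter group of diffeomorphisms of $V$: $\varphi_0=\mathrm{Id}$, $\varphi_{s+t}=\varphi_s\circ\varphi_t$ whenever $s,t,s+t\in I$, and the map $I\times V\to V$, $(s,x)\mapsto\varphi_s(x)$, is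 real-analytic. (The choice $I=[0,\infty)$ gives one-parameter monoids.) **Theorem.** If $\varphi_s\in\mathcal C(V,\mathbf g)$ for all $s\in I$ with $s\ge 0$, then $$\mu(\varphi_{s_0}^*\mathbf g|_x)=\mu(\varphi_{s_1}^*\mathbf g|_x)\qquad\text{for all } x\in V \text{ and all } s_0,s_1\in I \text{ with } s_0,s_1>0 .$$ -/

import Mathlib

open Set
open scoped Manifold ContDiff Topology

noncomputable section

namespace CausalSym

/-- A Lorentzian metric of class `C^k` on a manifold `V` of dimension `n`, with signature
`(+,-,…,-)`: a `C^k` field of symmetric bilinear forms on the tangent spaces such that at each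
point some vector `t` has `g(t,t) > 0` and `g` is negative definite on the `g`-orthogonal
complement of `t`. The metric is analytic for `k = ω`. -/
structure LorentzMetric (n : ℕ) (k : WithTop ℕ∞) (V : Type*) [TopologicalSpace V]
    [ChartedSpace (EuclideanSpace ℝ (Fin n)) V] [IsManifold (𝓡 n) ω V] where
  /-- the bilinear form `g|_x` -/
  val (x : V) : TangentSpace (𝓡 n) x →L[ℝ] TangentSpace (𝓡 n) x →L[ℝ] ℝ
  symm (x : V) (u v : TangentSpace (𝓡 n) x) : val x u v = val x v u
  signature (x : V) : ∃ t : TangentSpace (𝓡 n) x, 0 < val x t t ∧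
    ∀ v : TangentSpace (𝓡 n) x, val x t v = 0 → v ≠ 0 → val x v v < 0
  contMDiff : ContMDiff (𝓡 n)
    ((𝓡 n).prod 𝓘(ℝ, EuclideanSpace ℝ (Fin n) →L[ℝ] EuclideanSpace ℝ (Fin n) →L[ℝ] ℝ)) k
    (fun x ↦ Bundle.TotalSpace.mk'
      (EuclideanSpace ℝ (Fin n) →L[ℝ] EuclideanSpace ℝ (Fin n) →L[ℝ] ℝ) x (val x))

section

variable {n : ℕ} {k : WithTop ℕ∞} {V : Type*} [TopologicalSpace V]
  [ChartedSpace (EuclideanSpace ℝ (Fin n)) V] [IsManifold (𝓡 n) ω V]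

/-- A causal (time) orientation of `(V, g)`, given by a continuous timelike vector field on `V`,
which is declared to be future directed. -/
structure TimeOrientation (g : LorentzMetric n k V) where
  /-- the timelike vector field -/
  field (x : V) : TangentSpace (𝓡 n) x
  timelike (x : V) : 0 < g.val x (field x) (field x)
  continuous : Continuous fun x ↦ (⟨x, field x⟩ : TangentBundle (𝓡 n) V)

/-- The set `Θ⁺_x` of future-directed causal vectors at `x`. The second condition makes its
elements nonzero. -/
def futureCausal (g : LorentzMetric n k V) (τ : TimeOrientation g) (x : V) :
    Set (TangentSpace (𝓡 n) x) :=
  {u | 0 ≤ g.val x u u ∧ 0 < g.val x (τ.field x) u}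

/-- The set `C(V, g)` of causal symmetries: the smooth diffeomorphisms of `V` whose differential
maps future-directed causal vectors to future-directed causal vectors. -/
def causalSymmetries (g : LorentzMetric n k V) (τ : TimeOrientation g) :
    Set (V ≃ₘ⟮𝓡 n, 𝓡 n⟯ V) :=
  {φ | ∀ x : V, ∀ u ∈ futureCausal g τ x,
    mfderiv (𝓡 n) (𝓡 n) φ x u ∈ futureCausal g τ (φ x)}

/-- The value `φ^*g|_x` at `x` of the pull-back of `g` by `φ`. -/
def pullback (g : LorentzMetric n k V) (φ : V ≃ₘ⟮𝓡 n, 𝓡 n⟯ V) (x : V) :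
    TangentSpace (𝓡 n) x →L[ℝ] TangentSpace (𝓡 n) x →L[ℝ] ℝ :=
  (ContinuousLinearMap.precomp ℝ (mfderiv (𝓡 n) (𝓡 n) φ x)).comp
    ((g.val (φ x)).comp (mfderiv (𝓡 n) (𝓡 n) φ x))

theorem pullback_apply (g : LorentzMetric n k V) (φ : V ≃ₘ⟮𝓡 n, 𝓡 n⟯ V) (x : V)
    (u v : TangentSpace (𝓡 n) x) :
    pullback g φ x u v =
      g.val (φ x) (mfderiv (𝓡 n) (𝓡 n) φ x u) (mfderiv (𝓡 n) (𝓡 n) φ x v) :=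
  rfl

/-- The set `μ(T)` of principal directions of a covariant 2-tensor `T` at `x`: the future-directed
causal vectors `u` such that `T(u,u) = 0`. -/
def principalDirections (g : LorentzMetric n k V) (τ : TimeOrientation g) {x : V}
    (T : TangentSpace (𝓡 n) x →L[ℝ] TangentSpace (𝓡 n) x →L[ℝ] ℝ) :
    Set (TangentSpace (𝓡 n) x) :=
  {u | u ∈ futureCausal g τ x ∧ T u u = 0}

/-- `{φ_s}`, `s ∈ J`, is a real-analytic local one-parameter group of diffeomorphisms of `V`:
`J` is an interval containing `0`, `φ_0 = Id`, `φ_{s+t} = φ_s ∘ φ_t` as long as the parameters lie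
in `J`, and `(s, x) ↦ φ_s(x)` is analytic on `J × V`. The values of `φ` outside `J` play no role.
The choices `J = [0, ∞)` and `J = ℝ` give one-parameter monoids and groups. -/
structure IsAnalyticOneParameterGroup (J : Set ℝ) (φ : ℝ → (V ≃ₘ⟮𝓡 n, 𝓡 n⟯ V)) : Prop where
  ordConnected : J.OrdConnected
  zero_mem : (0 : ℝ) ∈ J
  map_zero : ∀ x : V, φ 0 x = x
  map_add : ∀ s ∈ J, ∀ t ∈ J, s + t ∈ J → ∀ x : V, φ (s + t) x = φ s (φ t x)
  analytic : ContMDiffOn (𝓘(ℝ, ℝ).prod (𝓡 n)) (𝓡 n) ω (fun p : ℝ × V ↦ φ p.1 p.2)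
    (J ×ˢ (univ : Set V))

end

end CausalSym

end

namespace CausalSym

/-! A causal symmetry keeps timelike future vectors timelike (`timelike_of_mem_causalSymmetries`).
Since `φ s = φ (s - r) ∘ φ r` for `0 ≤ r ≤ s`, a causal vector `u` that `φ s` makes null is
therefore already null after `φ r`. So `r ↦ (φ r)^*g(u, u)` vanishes on all of `[0, s]`; being
analytic in `r` (`contDiffOn_pullback`), it vanishes at later parameters too
(`eq_zero_of_contDiffOn_omega`). -/

theorem add_smul_apply {E : Type*} [AddCommGroup E] [Module ℝ E] [TopologicalSpace E]
    (T : E →L[ℝ] E →L[ℝ] ℝ)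
    (hT : ∀ u v, T u v = T v u) (u w : E) (ε : ℝ) :
    T (u + ε • w) (u + ε • w) = T u u + 2 * ε * T u w + ε ^ 2 * T w w := by
  simp only [map_add, map_smul, add_apply, smul_apply, smul_eq_mul, hT w u]
  ring

section

variable {n : ℕ} {k : WithTop ℕ∞} {V : Type*} [TopologicalSpace V]
  [ChartedSpace (EuclideanSpace ℝ (Fin n)) V] [IsManifold (𝓡 n) ω V]

/-- The timelike vectors are interior points of the cone of future-directed causal vectors. -/
theorem eventually_add_smul_mem_futureCausal (g : LorentzMetric n k V) (τ : TimeOrientation g)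
    {x : V} {u : TangentSpace (𝓡 n) x} (hu : u ∈ futureCausal g τ x) (huu : 0 < g.val x u u)
    (w : TangentSpace (𝓡 n) x) : ∀ᶠ ε : ℝ in 𝓝 0, u + ε • w ∈ futureCausal g τ x := by
  have h1 : ∀ᶠ ε : ℝ in 𝓝 0,
      0 < g.val x u u + 2 * ε * g.val x u w + ε ^ 2 * g.val x w w := by
    have hc : Continuous fun ε : ℝ ↦
        g.val x u u + 2 * ε * g.val x u w + ε ^ 2 * g.val x w w := by fun_prop
    exact hc.continuousAt.eventually (lt_mem_nhds (by simpa using huu))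
  have h2 : ∀ᶠ ε : ℝ in 𝓝 0, 0 < g.val x (τ.field x) u + ε * g.val x (τ.field x) w := by
    have hc : Continuous fun ε : ℝ ↦
        g.val x (τ.field x) u + ε * g.val x (τ.field x) w := by fun_prop
    exact hc.continuousAt.eventually (lt_mem_nhds (by simpa using hu.2))
  filter_upwards [h1, h2] with ε h1 h2
  refine ⟨?_, ?_⟩
  · rw [add_smul_apply _ (g.symm x)]
    exact h1.le
  · rwa [map_add, map_smul, smul_eq_mul]

/-- A nonzero linear term would dominate near `0` and change sign. This kills the first variation of
a quadratic form at a minimum. -/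
theorem eq_zero_of_eventually_nonneg {a b : ℝ}
    (h : ∀ᶠ ε : ℝ in 𝓝 0, 0 ≤ 2 * ε * a + ε ^ 2 * b) : a = 0 := by
  have hmin : IsLocalMin (fun ε : ℝ ↦ 2 * ε * a + ε ^ 2 * b) 0 := by
    filter_upwards [h] with ε hε
    simpa using hε
  have hd : HasDerivAt (fun ε : ℝ ↦ 2 * ε * a + ε ^ 2 * b) (2 * a) 0 := by
    have h1 := (((hasDerivAt_id (0 : ℝ)).const_mul 2).mul_const a).add
      (((hasDerivAt_id (0 : ℝ)).pow 2).mul_const b)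
    convert! h1 using 1
    simp
  linarith [hmin.hasDerivAt_eq_zero hd]

/-- Causal symmetries map timelike future-directed vectors to timelike ones. -/
theorem timelike_of_mem_causalSymmetries {g : LorentzMetric n k V} {τ : TimeOrientation g}
    {φ : V ≃ₘ⟮𝓡 n, 𝓡 n⟯ V} (hφ : φ ∈ causalSymmetries g τ) {x : V}
    {u : TangentSpace (𝓡 n) x} (hu : u ∈ futureCausal g τ x) (huu : 0 < g.val x u u) :
    0 < pullback g φ x u u := by
  have hAu := hφ x u hu
  refine lt_of_le_of_ne hAu.1 fun h0 ↦ ?_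
  -- If `u` became null, the pulled-back form, nonnegative on the cone, would attain its minimum `0`
  -- at the interior point `u`; hence `u` would lie in its radical.
  have key : ∀ w, pullback g φ x u w = 0 := by
    intro w
    refine eq_zero_of_eventually_nonneg (b := pullback g φ x w w) ?_
    filter_upwards [eventually_add_smul_mem_futureCausal g τ hu huu w] with ε hε
    have h := (hφ x _ hε).1
    rw [← pullback_apply, add_smul_apply (pullback g φ x) (fun u v ↦ g.symm _ _ _), ← h0, zero_add] at h
    exact h
  -- Testing the radical on the preimage of `τ` contradicts the image of `u` being future directed.
  obtain ⟨w, hw⟩ := (φ.mfderivToContinuousLinearEquiv (x := x) (by simp)).surjective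
    (τ.field (φ x))
  have hw' : mfderiv (𝓡 n) (𝓡 n) φ x w = τ.field (φ x) := hw
  have h1 := key w
  rw [pullback_apply, hw', g.symm] at h1
  exact hAu.2.ne' h1

/-- Principal directions of the pull-back by a composition with a causal symmetry are principal
directions of the pull-back by the inner factor. -/
theorem pullback_eq_zero_of_comp {g : LorentzMetric n k V} {τ : TimeOrientation g}
    {φ ψ χ : V ≃ₘ⟮𝓡 n, 𝓡 n⟯ V} (hφ : φ ∈ causalSymmetries g τ)
    (hψ : ψ ∈ causalSymmetries g τ) (hχ : ∀ y, χ y = ψ (φ y)) {x : V}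
    {u : TangentSpace (𝓡 n) x} (hu : u ∈ futureCausal g τ x) (h : pullback g χ x u u = 0) :
    pullback g φ x u u = 0 := by
  have hAu := hφ x u hu
  refine (hAu.1.eq_or_lt.resolve_right fun hlt ↦ ?_).symm
  have h2 := timelike_of_mem_causalSymmetries hψ hAu hlt
  have hfun : (χ : V → V) = ψ ∘ φ := funext hχ
  have hd : mfderiv (𝓡 n) (𝓡 n) χ x =
      (mfderiv (𝓡 n) (𝓡 n) ψ (φ x)).comp (mfderiv (𝓡 n) (𝓡 n) φ x) := by
    rw [hfun]
    exact mfderiv_comp x (ψ.mdifferentiable (by simp) _) (φ.mdifferentiable (by simp) _)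
  have h3 : pullback g χ x u u = pullback g ψ (φ x) (mfderiv (𝓡 n) (𝓡 n) φ x u)
      (mfderiv (𝓡 n) (𝓡 n) φ x u) := by
    -- `χ x` and `ψ (φ x)` are only propositionally equal, so vectors at the two points are compared
    -- through the model space.
    have e : ∀ (y z : V), y = z → ∀ v : EuclideanSpace ℝ (Fin n),
        g.val y v v = g.val z v v := by
      rintro y _ rfl v
      rfl
    rw [pullback_apply, pullback_apply, hd]
    exact e _ _ (hχ x) _
  exact h2.ne' (h3 ▸ h)

/-- The pull-backs of an analytic metric by an analytic one-parameter family, evaluated on a fixed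
vector, depend analytically on the parameter. -/
theorem contDiffOn_pullback (g : LorentzMetric n ω V) {J : Set ℝ}
    {φ : ℝ → (V ≃ₘ⟮𝓡 n, 𝓡 n⟯ V)}
    (hφ : ContMDiffOn (𝓘(ℝ, ℝ).prod (𝓡 n)) (𝓡 n) ω (fun p : ℝ × V ↦ φ p.1 p.2)
      (J ×ˢ (univ : Set V)))
    (x : V) (u : TangentSpace (𝓡 n) x) :
    ContDiffOn ℝ ω (fun t ↦ pullback g (φ t) x u u) J := by
  -- Differentiating in `x` costs one order of smoothness, which is harmless because `ω + 1` is `ω`.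
  have : IsManifold (𝓡 n) (ω + 1) V := inferInstanceAs (IsManifold (𝓡 n) ω V)
  have : IsManifold (𝓡 n) 1 V := IsManifold.of_le (n := ω) le_top
  rw [← contMDiffOn_iff_contDiffOn]
  intro t ht
  have hb : ContMDiffWithinAt 𝓘(ℝ, ℝ) (𝓡 n) ω (fun s ↦ φ s x) J t :=
    ContMDiffWithinAt.comp (f := fun s : ℝ ↦ (s, x)) t (hφ (t, x) ⟨ht, mem_univ x⟩)
      (contMDiffWithinAt_id.prodMk contMDiffWithinAt_const) fun s hs ↦ ⟨hs, mem_univ x⟩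
  have hd := ContMDiffWithinAt.mfderivWithin (m := ω) (f := fun s y ↦ φ s y) (g := fun _ : ℝ ↦ x)
    (hφ (t, x) ⟨ht, mem_univ x⟩) contMDiffWithinAt_const ht (mapsTo_univ _ _) (by simp)
    (uniqueMDiffOn_univ (I := 𝓡 n))
  simp only [mfderivWithin_univ] at hd
  have hv : ContMDiffWithinAt 𝓘(ℝ, ℝ) ((𝓡 n).prod 𝓘(ℝ, EuclideanSpace ℝ (Fin n))) ω
      (fun s ↦ Bundle.TotalSpace.mk' (EuclideanSpace ℝ (Fin n)) (E := TangentSpace (𝓡 n)) (φ s x)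
        (mfderiv (𝓡 n) (𝓡 n) (φ s) x u)) J t :=
    ContMDiffWithinAt.clm_apply_of_inCoordinates (IB₁ := 𝓡 n) (IB₂ := 𝓡 n)
      (E₁ := TangentSpace (𝓡 n)) (E₂ := TangentSpace (𝓡 n)) (F₁ := EuclideanSpace ℝ (Fin n))
      (F₂ := EuclideanSpace ℝ (Fin n)) (b₁ := fun _ : ℝ ↦ x) (b₂ := fun s ↦ φ s x)
      (v := fun _ ↦ u) (ϕ := fun s ↦ mfderiv (𝓡 n) (𝓡 n) (φ s) x)
      hd contMDiffWithinAt_const hb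
  have : ContMDiffWithinAt 𝓘(ℝ, ℝ) ((𝓡 n).prod 𝓘(ℝ, ℝ)) ω
      (fun s ↦ Bundle.TotalSpace.mk' ℝ (E := Bundle.Trivial V ℝ) (φ s x)
        (g.val (φ s x) (mfderiv (𝓡 n) (𝓡 n) (φ s) x u) (mfderiv (𝓡 n) (𝓡 n) (φ s) x u))) J t := by
    apply ContMDiffWithinAt.clm_bundle_apply₂ (F₁ := EuclideanSpace ℝ (Fin n))
      (F₂ := EuclideanSpace ℝ (Fin n))
    · exact ContMDiffAt.comp_contMDiffWithinAt t g.contMDiff.contMDiffAt hb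
    · exact hv
    · exact hv
  simp only [Bundle.contMDiffWithinAt_totalSpace] at this
  exact this.2

end

/-- Identity theorem on a real interval, the end points included. -/
theorem eq_zero_of_contDiffOn_omega {f : ℝ → ℝ} {J : Set ℝ} (hJ : J.OrdConnected)
    (hf : ContDiffOn ℝ ω f J) {a b c : ℝ} (ha : a ∈ J) (hc : c ∈ J) (hab : a < b) (hbc : b ≤ c)
    (h0 : ∀ t ∈ Ioo a b, f t = 0) : f c = 0 := by
  have hsub : Icc a c ⊆ J := hJ.out ha hc
  have hac : a < c := hab.trans_le hbc
  have han : AnalyticOnNhd ℝ f (Ioo a c) := fun t ht ↦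
    (hf.contDiffAt (Filter.mem_of_superset (Icc_mem_nhds ht.1 ht.2) hsub)).analyticAt
  obtain ⟨m, hm⟩ := exists_between hab
  have hzero : EqOn f 0 (Ioo a c) := by
    refine han.eqOn_zero_of_preconnected_of_eventuallyEq_zero isPreconnected_Ioo
      ⟨hm.1, hm.2.trans_le hbc⟩ ?_
    filter_upwards [Ioo_mem_nhds hm.1 hm.2] with t ht using h0 t ht
  -- `c` may be an end point of `J`, so the value there comes from continuity rather than from the
  -- identity theorem.
  have hcont : ContinuousWithinAt f (Ioo a c) c :=
    (hf.continuousOn c hc).mono (Ioo_subset_Icc_self.trans hsub)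
  have hmem : c ∈ closure (Ioo a c) := by
    rw [closure_Ioo hac.ne]
    exact right_mem_Icc.2 hac.le
  simpa using hcont.mem_closure (t := {0}) hmem fun t ht ↦ hzero ht

/-- Times `t ≤ s` are reached by factoring `φ s`, times `t ≥ s` by analytic continuation from `(0,
s)`. As `s` and `t` are in no fixed order, swapping them gives the reverse inclusion. -/
theorem principalDirections_pullback_subset {n : ℕ} {V : Type*} [TopologicalSpace V]
    [ChartedSpace (EuclideanSpace ℝ (Fin n)) V] [IsManifold (𝓡 n) ω V]
    {g : LorentzMetric n ω V} {τ : TimeOrientation g}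
    {J : Set ℝ} {φ : ℝ → (V ≃ₘ⟮𝓡 n, 𝓡 n⟯ V)} (hφ : IsAnalyticOneParameterGroup J φ)
    (hcausal : ∀ s ∈ J, 0 ≤ s → φ s ∈ causalSymmetries g τ)
    (x : V) {s t : ℝ} (hs : s ∈ J) (ht : t ∈ J) (hs0 : 0 < s) (ht0 : 0 < t) :
    principalDirections g τ (pullback g (φ s) x) ⊆
      principalDirections g τ (pullback g (φ t) x) := by
  rintro u ⟨hu, h⟩
  refine ⟨hu, ?_⟩
  have hmem : ∀ r, 0 ≤ r → r ≤ s → r ∈ J := fun r h1 h2 ↦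
    hφ.ordConnected.out hφ.zero_mem hs ⟨h1, h2⟩
  have hle : ∀ r, 0 ≤ r → r ≤ s → pullback g (φ r) x u u = 0 := by
    intro r h1 h2
    have hr := hmem r h1 h2
    have hsr := hmem (s - r) (by linarith) (by linarith)
    refine pullback_eq_zero_of_comp (hcausal r hr h1) (hcausal (s - r) hsr (by linarith))
      (χ := φ s) (fun y ↦ ?_) hu h
    have := hφ.map_add (s - r) hsr r hr (by simpa using hs) y
    rwa [sub_add_cancel] at this
  rcases le_total t s with hts | hst
  · exact hle t ht0.le hts
  · exact eq_zero_of_contDiffOn_omega hφ.ordConnected (contDiffOn_pullback g hφ.analytic x u)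
      hφ.zero_mem ht hs0 hst fun r hr ↦ hle r hr.1.le hr.2.le

end CausalSym

theorem mainTheorem3 (n : ℕ) {V : Type*} [TopologicalSpace V]
    [ChartedSpace (EuclideanSpace ℝ (Fin n)) V] [IsManifold (𝓡 n) ω V]
    (g : CausalSym.LorentzMetric n ω V) (τ : CausalSym.TimeOrientation g)
    (J : Set ℝ) (φ : ℝ → (V ≃ₘ⟮𝓡 n, 𝓡 n⟯ V))
    (hφ : CausalSym.IsAnalyticOneParameterGroup J φ)
    (hcausal : ∀ s ∈ J, 0 ≤ s → φ s ∈ CausalSym.causalSymmetries g τ)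
    (x : V) (s₀ s₁ : ℝ) (hs₀ : s₀ ∈ J) (hs₁ : s₁ ∈ J) (h₀ : 0 < s₀) (h₁ : 0 < s₁) :
    CausalSym.principalDirections g τ (CausalSym.pullback g (φ s₀) x) =
      CausalSym.principalDirections g τ (CausalSym.pullback g (φ s₁) x) :=
  Subset.antisymm
    (CausalSym.principalDirections_pullback_subset hφ hcausal x hs₀ hs₁ h₀ h₁)
    (CausalSym.principalDirections_pullback_subset hφ hcausal x hs₁ hs₀ h₁ h₀)
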